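/- Let $n\ge 5$ be an integer, let $1<p_1,\dots,p_n\le\infty$ and $0<p<\infty$ satisfy $\frac1{p_1}+\dots+\frac1{p_n}=\frac1p$, and let $k$ be an integer with $$n-\Big(\frac{n-1}{2}\Big)^{1/2}<k\le n .$$ Then there exist a non-degenerate linear subspace $\Gamma\subseteq\mathbb R^n$ with $\dim\Gamma=k$ and a symbol $m\in\mathcal M_\Gamma(\mathbb R^n)$ such that the $n$-linear multiplier operator $$T_m(f_1,\dots,f_n)(x)=\int_{\mathbb R^n} m(\eta)\,\widehat{f_1}(\eta_1)\cdots\widehat{f_n}(\eta_n)\,e^{2\pi i x(\eta_1+\dots+\eta_n)}\,d\eta$$ does not map $L^{p_1}\times\dots\times L^{p_n}$ into $L^p$; that is, there is no constant $C<\infty$ with $\|T_m(f_1,\dots,f_n)\|_{L^p(\mathbb R)}\le C\prod_{j=1}^n\|f_j\|_{L^{p_j}(\mathbb R)}$ for all Schwartz functions $f_1,\dots,f_n:\mathbb R\to\mathbb C$. Here a subspace $\Gamma$ of dimension $k$ is non-degenerate if, writing $\xi_{n+1}=-(\xi_1+\dots+\xi_n)$ for $\xi\in\mathbb R^n$, it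 is a graph over any $k$ of the $n+1$ variables $\xi_1,\dots,\xi_{n+1}$: for all $1\le i_1<\dots<i_k\le n+1$ the map $\Gamma\to\mathbb R^k$, $\xi\mapsto(\xi_{i_1},\dots,\xi_{i_k})$, is bijective. The class $\mathcal M_\Gamma(\mathbb R^n)$ consists of all bounded measurable functions $m:\mathbb R^n\to\mathbb C$ that are smooth on $\mathbb R^n\setminus\Gamma$ and satisfy $|\partial^\gamma m(\eta)|\le C_\gamma\,\mathrm{dist}(\eta,\Gamma)^{-|\gamma|}$ for every multi-index $\gamma$ and all $\eta\notin\Gamma$. -/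

import Mathlib

open MeasureTheory
open scoped ENNReal NNReal ContDiff FourierTransform SchwartzMap

noncomputable section

/-- The `n + 1` frequency variables attached to `ξ ∈ ℝⁿ`: its coordinates `ξ₁, …, ξₙ`
together with the dual variable `ξₙ₊₁ = -(ξ₁ + ⋯ + ξₙ)`. -/
def frequencyVars {n : ℕ} (ξ : EuclideanSpace ℝ (Fin n)) : Fin (n + 1) → ℝ :=
  Fin.snoc (α := fun _ => ℝ) (fun i : Fin n => ξ i) (-∑ i, ξ i)

/-- Non-degeneracy in the sense of Muscalu, Tao and Thiele: `Γ`, of dimension `k`, is a graph over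
any `k` of the `n + 1` variables `ξ₁, …, ξₙ, ξₙ₊₁`, where `ξ₁ + ⋯ + ξₙ + ξₙ₊₁ = 0`. -/
def IsNondegenerateSubspace {n : ℕ} (Γ : Submodule ℝ (EuclideanSpace ℝ (Fin n))) : Prop :=
  ∀ S : Finset (Fin (n + 1)), S.card = Module.finrank ℝ Γ →
    Function.Bijective (fun (ξ : Γ) (i : S) =>
      frequencyVars (ξ : EuclideanSpace ℝ (Fin n)) (i : Fin (n + 1)))

/-- The class `𝓜_Γ(ℝⁿ)` of Marcinkiewicz–Hörmander–Mikhlin symbols singular along `Γ`: bounded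
(measurable) functions, smooth off `Γ`, whose derivatives of each order `j` are
`O(dist(η, Γ)^{-j})`. -/
structure IsMikhlinSymbol {n : ℕ} (Γ : Submodule ℝ (EuclideanSpace ℝ (Fin n)))
    (m : EuclideanSpace ℝ (Fin n) → ℂ) : Prop where
  measurable : AEStronglyMeasurable m volume
  bounded : ∃ C : ℝ, ∀ η, ‖m η‖ ≤ C
  smooth : ContDiffOn ℝ (∞ : WithTop ℕ∞) m (Γ : Set (EuclideanSpace ℝ (Fin n)))ᶜ
  decay : ∀ j : ℕ, ∃ C : ℝ, ∀ η ∉ Γ,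
    ‖iteratedFDeriv ℝ j m η‖ ≤ C / Metric.infDist η (Γ : Set (EuclideanSpace ℝ (Fin n))) ^ j

/-- The `n`-linear multiplier operator
`T_m(f₁, …, fₙ)(x) = ∫_{ℝⁿ} m(η) f̂₁(η₁) ⋯ f̂ₙ(ηₙ) e^{2πix(η₁ + ⋯ + ηₙ)} dη`. -/
def multilinearMultiplier {n : ℕ} (m : EuclideanSpace ℝ (Fin n) → ℂ) (f : Fin n → ℝ → ℂ)
    (x : ℝ) : ℂ :=
  ∫ η : EuclideanSpace ℝ (Fin n),
    m η * (∏ i, 𝓕 (f i) (η i)) *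
      Complex.exp (2 * Real.pi * Complex.I * (x : ℂ) * ((∑ i, η i : ℝ) : ℂ))

/-- `T_m` maps `L^{p₁} × ⋯ × L^{pₙ}` into `L^q`: the a priori estimate
`‖T_m(f₁, …, fₙ)‖_q ≤ C ‖f₁‖_{p₁} ⋯ ‖fₙ‖_{pₙ}` holds for all Schwartz functions. -/
def MapsLp {n : ℕ} (m : EuclideanSpace ℝ (Fin n) → ℂ) (p : Fin n → ℝ≥0∞) (q : ℝ≥0∞) : Prop :=
  ∃ C : ℝ≥0, ∀ f : Fin n → 𝓢(ℝ, ℂ),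
    eLpNorm (multilinearMultiplier m (fun i => (f i : ℝ → ℂ))) q volume ≤
      C * ∏ i, eLpNorm (f i : ℝ → ℂ) (p i) volume

end

/-! The failure comes from counting lattice points against flat exponential sums. Let `Γ` have
dimension `k`, and suppose that its slice by the hyperplane of coordinate sum zero contains at least
a constant times `N ^ (k - 1)` integer points with all coordinates in `[-N, N)`. Put a bump at each
such point `v`, with coefficient `∏ r(v_i)`, where `r` is the Rudin–Shapiro sign. Feed in `n` copies
of the function with Fourier transform `∑ r(a) b(ξ - a)`, `-N ≤ a < N`. All signs square to one and
all phases cancel, so the output is the number of points times `(𝓕⁻ b) ^ n`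
(`multilinearMultiplier_signWeight`). The flatness of Rudin–Shapiro sums bounds each input by `√(8N)
|𝓕⁻ b|` pointwise, hence in every `L^p`. An estimate would thus force `N ^ (k - 1) ≲ N ^ (n / 2)`,
which is false for large `N` when `2 (k - 1) > n`. The hypothesis on `k` implies this.

A non-degenerate `Γ` with many integer points is obtained from the vectors `(-1) ^ i * n.choose i *
P(i)`, `deg P < k`. The dual variable obeys the same formula at `i = n`, because the `n`-th
difference of `P` vanishes; non-degeneracy then says that such a `P` with `k` roots is zero. -/

/-! ### Rudin–Shapiro signs and flat exponential sums. -/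

/-- The Rudin–Shapiro sequence. -/
def rudinShapiro (a : ℕ) : ℝ :=
  if h : a = 0 then 1
  else if a % 2 = 0 then rudinShapiro (a / 2) else (-1) ^ (a / 2) * rudinShapiro (a / 2)
termination_by a
decreasing_by all_goals omega

theorem rudinShapiro_zero : rudinShapiro 0 = 1 := by
  rw [rudinShapiro]; simp

theorem rudinShapiro_two_mul (a : ℕ) : rudinShapiro (2 * a) = rudinShapiro a := by
  rcases Nat.eq_zero_or_pos a with rfl | ha
  · rfl
  · rw [rudinShapiro, dif_neg (by omega), if_pos (by omega)]
    congr 1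
    omega

theorem rudinShapiro_two_mul_add_one (a : ℕ) :
    rudinShapiro (2 * a + 1) = (-1) ^ a * rudinShapiro a := by
  rw [rudinShapiro, dif_neg (by omega), if_neg (by omega), show (2 * a + 1) / 2 = a by omega]

theorem rudinShapiro_sq (a : ℕ) : rudinShapiro a ^ 2 = 1 := by
  induction a using Nat.strong_induction_on with
  | _ a ih =>
    rcases Nat.eq_zero_or_pos a with rfl | ha
    · simp [rudinShapiro_zero]
    · rcases Nat.even_or_odd' a with ⟨b, rfl | rfl⟩
      · rw [rudinShapiro_two_mul, ih b (by omega)]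
      · rw [rudinShapiro_two_mul_add_one, mul_pow, ih b (by omega), ← pow_mul, mul_comm b, pow_mul]
        simp

/-- The Rudin–Shapiro polynomial with `2 ^ r` terms. -/
def rudinShapiroPoly (r : ℕ) (z : ℂ) : ℂ :=
  ∑ a ∈ Finset.range (2 ^ r), (rudinShapiro a : ℂ) * z ^ a

theorem sum_range_two_mul {M : Type*} [AddCommMonoid M] (F : ℕ → M) (N : ℕ) :
    ∑ a ∈ Finset.range (2 * N), F a =
      ∑ a ∈ Finset.range N, F (2 * a) + ∑ a ∈ Finset.range N, F (2 * a + 1) := by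
  induction N with
  | zero => simp
  | succ N ih =>
    rw [show 2 * (N + 1) = 2 * N + 1 + 1 by ring, Finset.sum_range_succ, Finset.sum_range_succ, ih,
      Finset.sum_range_succ, Finset.sum_range_succ]
    abel

theorem rudinShapiroPoly_succ (r : ℕ) (z : ℂ) :
    rudinShapiroPoly (r + 1) z = rudinShapiroPoly r (z ^ 2) + z * rudinShapiroPoly r (-z ^ 2) := by
  unfold rudinShapiroPoly
  rw [pow_succ' 2 r, sum_range_two_mul, Finset.mul_sum]
  congr 1
  · refine Finset.sum_congr rfl fun a _ => ?_
    rw [rudinShapiro_two_mul, pow_mul]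
  · refine Finset.sum_congr rfl fun a _ => ?_
    rw [rudinShapiro_two_mul_add_one, neg_pow (z ^ 2)]
    push_cast
    ring

/-- The values at `z` and `-z` of the next polynomial are the sum and difference of the same two
numbers, so the parallelogram law doubles the total at each step. -/
theorem norm_rudinShapiroPoly_sq_add (r : ℕ) {z : ℂ} (hz : ‖z‖ = 1) :
    ‖rudinShapiroPoly r z‖ ^ 2 + ‖rudinShapiroPoly r (-z)‖ ^ 2 = 2 * 2 ^ r := by
  induction r generalizing z with
  | zero => simp [rudinShapiroPoly, rudinShapiro_zero]; norm_num
  | succ r ih =>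
    have h := ih (z := z ^ 2) (by simp [hz])
    have par := parallelogram_law_with_norm ℝ (rudinShapiroPoly r (z ^ 2))
      (z * rudinShapiroPoly r (-z ^ 2))
    rw [rudinShapiroPoly_succ, rudinShapiroPoly_succ, neg_sq, neg_mul, ← sub_eq_add_neg]
    rw [norm_mul, hz, one_mul] at par
    rw [par, h, pow_succ']

theorem norm_rudinShapiroPoly_sq_le (r : ℕ) {z : ℂ} (hz : ‖z‖ = 1) :
    ‖rudinShapiroPoly r z‖ ^ 2 ≤ 2 * 2 ^ r := by
  have := norm_rudinShapiroPoly_sq_add r hz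
  nlinarith [sq_nonneg ‖rudinShapiroPoly r (-z)‖]

/-- The Rudin–Shapiro sequence reflected to all integers. -/
def rudinShapiroInt : ℤ → ℝ
  | .ofNat a => rudinShapiro a
  | .negSucc a => rudinShapiro a

theorem rudinShapiroInt_sq (a : ℤ) : rudinShapiroInt a ^ 2 = 1 := by
  cases a <;> exact rudinShapiro_sq _

theorem abs_rudinShapiroInt (a : ℤ) : |rudinShapiroInt a| = 1 := by
  rw [← sq_eq_sq₀ (abs_nonneg _) zero_le_one, sq_abs, rudinShapiroInt_sq, one_pow]

theorem sum_Ico_neg_eq {M : Type*} [AddCommMonoid M] (F : ℤ → M) (N : ℕ) :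
    ∑ a ∈ Finset.Ico (-N : ℤ) N, F a =
      ∑ a ∈ Finset.range N, F a + ∑ a ∈ Finset.range N, F (Int.negSucc a) := by
  induction N with
  | zero => simp
  | succ N ih =>
    have h : Finset.Ico (-(N + 1 : ℕ) : ℤ) (N + 1 : ℕ) =
        insert (N : ℤ) (insert (Int.negSucc N) (Finset.Ico (-N : ℤ) N)) := by
      ext x; simp only [Finset.mem_Ico, Finset.mem_insert, Int.negSucc_eq]; push_cast; omega
    rw [h, Finset.sum_insert, Finset.sum_insert, ih, Finset.sum_range_succ, Finset.sum_range_succ]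
    · abel
    · simp [Int.negSucc_eq]
    · simp only [Finset.mem_Ico, Finset.mem_insert, Int.negSucc_eq]; omega

/-- The negative frequencies contribute `z⁻¹` times the polynomial at `z⁻¹`. Each half has square at
most `2 * 2 ^ r`, and `(x + y)² ≤ 2 (x² + y²)` gives the `8`. -/
theorem norm_sum_rudinShapiroInt_sq_le (r : ℕ) {z : ℂ} (hz : ‖z‖ = 1) :
    ‖∑ a ∈ Finset.Ico (-(2 ^ r : ℕ) : ℤ) (2 ^ r : ℕ), (rudinShapiroInt a : ℂ) * z ^ a‖ ^ 2 ≤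
      8 * 2 ^ r := by
  have h0 : z ≠ 0 := by rintro rfl; simp at hz
  rw [sum_Ico_neg_eq]
  have h1 : ∑ a ∈ Finset.range (2 ^ r), (rudinShapiroInt a : ℂ) * z ^ (a : ℤ) =
      rudinShapiroPoly r z := rfl
  have h2 : ∑ a ∈ Finset.range (2 ^ r), (rudinShapiroInt (Int.negSucc a) : ℂ) *
      z ^ (Int.negSucc a) = z⁻¹ * rudinShapiroPoly r z⁻¹ := by
    unfold rudinShapiroPoly
    rw [Finset.mul_sum]
    refine Finset.sum_congr rfl fun a _ => ?_
    rw [zpow_negSucc, inv_pow, pow_succ, mul_inv]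
    simp only [rudinShapiroInt]
    ring
  rw [h1, h2]
  have e1 := norm_rudinShapiroPoly_sq_le r hz
  have e2 := norm_rudinShapiroPoly_sq_le r (z := z⁻¹) (by simp [hz])
  have e3 := norm_add_le (rudinShapiroPoly r z) (z⁻¹ * rudinShapiroPoly r z⁻¹)
  rw [norm_mul, norm_inv, hz, inv_one, one_mul] at e3
  have e4 := pow_le_pow_left₀ (norm_nonneg _) e3 2
  nlinarith [sq_nonneg (‖rudinShapiroPoly r z‖ - ‖rudinShapiroPoly r z⁻¹‖)]

/-! ### A non-degenerate subspace built from polynomial values. -/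

open Polynomial in
/-- The signed binomial weights times the values of a polynomial at `0, …, n - 1`. -/
noncomputable def binomialEval (n : ℕ) : ℝ[X] →ₗ[ℝ] EuclideanSpace ℝ (Fin n) where
  toFun P := WithLp.toLp 2 fun i => (-1) ^ (i : ℕ) * (n.choose i : ℝ) * P.eval (i : ℝ)
  map_add' P Q := by ext i; simp [mul_add]
  map_smul' c P := by ext i; simp; ring

theorem binomialEval_apply (n : ℕ) (P : Polynomial ℝ) (i : Fin n) :
    binomialEval n P i = (-1) ^ (i : ℕ) * (n.choose i : ℝ) * P.eval (i : ℝ) := rfl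

/-- Up to the sign `(-1) ^ n`, this is the `n`-th forward difference of `P` at `0`. -/
theorem sum_range_choose_mul_eval {n : ℕ} {P : Polynomial ℝ} (hP : P.natDegree < n) :
    ∑ i ∈ Finset.range (n + 1), (-1) ^ i * (n.choose i : ℝ) * P.eval (i : ℝ) = 0 := by
  have h := congrFun (Polynomial.fwdDiff_iter_eq_zero_of_degree_lt hP) 0
  rw [fwdDiff_iter_eq_sum_shift] at h
  have h' := congrArg ((-1 : ℝ) ^ n * ·) h
  simp only [Pi.zero_apply, mul_zero, Finset.mul_sum] at h'
  rw [← h']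
  refine Finset.sum_congr rfl fun i hi => ?_
  have hi' : i ≤ n := by simpa [Nat.lt_succ_iff] using hi
  have e : (-1 : ℝ) ^ n * (-1) ^ (n - i) = (-1) ^ i := by
    obtain ⟨j, rfl⟩ := Nat.exists_eq_add_of_le hi'
    rw [Nat.add_sub_cancel_left, pow_add, mul_assoc, ← mul_pow]
    simp
  rw [zsmul_eq_mul]
  push_cast
  rw [← mul_assoc, ← mul_assoc, e]
  simp

/-- All `n + 1` variables, the dual one included, are nonzero multiples of the values of `P` at `0,
…, n`. This makes the variables interchangeable for non-degeneracy. -/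
theorem frequencyVars_binomialEval {n : ℕ} {P : Polynomial ℝ} (hP : P.natDegree < n)
    (i : Fin (n + 1)) :
    frequencyVars (binomialEval n P) i = (-1) ^ (i : ℕ) * (n.choose i : ℝ) * P.eval (i : ℝ) := by
  unfold frequencyVars
  refine Fin.lastCases ?_ (fun i => ?_) i
  · have h := sum_range_choose_mul_eval hP
    rw [Finset.sum_range_succ, Finset.sum_range] at h
    rw [Fin.snoc_last]
    simp only [binomialEval_apply, Fin.val_last]
    linarith
  · rw [Fin.snoc_castSucc]; rfl

theorem natDegree_lt_of_mem_degreeLT {k n : ℕ} (hn : 0 < n) (hkn : k ≤ n) {P : Polynomial ℝ}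
    (hP : P ∈ Polynomial.degreeLT ℝ k) : P.natDegree < n := by
  rcases eq_or_ne P 0 with rfl | h0
  · simpa
  · rw [Polynomial.natDegree_lt_iff_degree_lt h0]
    exact (Polynomial.mem_degreeLT.1 hP).trans_le (by exact_mod_cast hkn)

/-- A polynomial of degree less than `k` is determined by `k` of the frequency variables. -/
theorem eq_zero_of_frequencyVars_binomialEval {k n : ℕ} (hn : 0 < n) (hkn : k ≤ n)
    {P : Polynomial ℝ} (hP : P ∈ Polynomial.degreeLT ℝ k) (S : Finset (Fin (n + 1)))
    (hS : k ≤ S.card) (h : ∀ i ∈ S, frequencyVars (binomialEval n P) i = 0) : P = 0 := by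
  refine Polynomial.eq_zero_of_degree_lt_of_eval_finset_eq_zero 
    (S.image fun i : Fin (n + 1) => ((i : ℕ) : ℝ)) ?_ ?_
  · rw [Finset.card_image_of_injective _ fun a b hab => Fin.ext (Nat.cast_injective hab)]
    exact (Polynomial.mem_degreeLT.1 hP).trans_le (by exact_mod_cast hS)
  · intro x hx
    obtain ⟨i, hi, rfl⟩ := Finset.mem_image.1 hx
    have := h i hi
    rw [frequencyVars_binomialEval (natDegree_lt_of_mem_degreeLT hn hkn hP)] at this
    have hc : (n.choose i : ℝ) ≠ 0 := by
      exact_mod_cast (Nat.choose_pos (Nat.lt_succ_iff.1 i.2)).ne'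
    simpa [hc] using this

theorem binomialEval_injOn {k n : ℕ} (hn : 0 < n) (hkn : k ≤ n) :
    Set.InjOn (binomialEval n) (Polynomial.degreeLT ℝ k : Set (Polynomial ℝ)) := by
  intro P hP Q hQ h
  have h0 : binomialEval n (P - Q) = 0 := by rw [map_sub, h, sub_self]
  refine sub_eq_zero.1 (eq_zero_of_frequencyVars_binomialEval hn hkn (Submodule.sub_mem _ hP hQ)
    Finset.univ (by simp; omega) fun i _ => ?_)
  rw [h0]
  unfold frequencyVars
  refine Fin.lastCases ?_ (fun i => ?_) i <;> simp

/-- The image of the polynomials of degree less than `k` under `binomialEval n`. -/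
noncomputable def binomialSubspace (n k : ℕ) : Submodule ℝ (EuclideanSpace ℝ (Fin n)) :=
  (Polynomial.degreeLT ℝ k).map (binomialEval n)

theorem finrank_binomialSubspace {k n : ℕ} (hn : 0 < n) (hkn : k ≤ n) :
    Module.finrank ℝ (binomialSubspace n k) = k := by
  have e : Polynomial.degreeLT ℝ k ≃ₗ[ℝ] binomialSubspace n k := by
    refine LinearEquiv.ofBijective
      ((binomialEval n).restrict fun P hP => Submodule.mem_map_of_mem hP) ⟨?_, ?_⟩
    · intro P Q h
      exact Subtype.ext (binomialEval_injOn hn hkn P.2 Q.2 (congrArg Subtype.val h))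
    · rintro ⟨_, P, hP, rfl⟩
      exact ⟨⟨P, hP⟩, rfl⟩
  rw [← e.finrank_eq, (Polynomial.degreeLTEquiv ℝ k).finrank_eq, Module.finrank_fin_fun]

theorem frequencyVars_add {n : ℕ} (ξ ζ : EuclideanSpace ℝ (Fin n)) (i : Fin (n + 1)) :
    frequencyVars (ξ + ζ) i = frequencyVars ξ i + frequencyVars ζ i := by
  unfold frequencyVars
  refine Fin.lastCases ?_ (fun i => ?_) i
  · simp [Finset.sum_add_distrib, add_comm]
  · simp

theorem frequencyVars_smul {n : ℕ} (c : ℝ) (ξ : EuclideanSpace ℝ (Fin n)) (i : Fin (n + 1)) :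
    frequencyVars (c • ξ) i = c * frequencyVars ξ i := by
  unfold frequencyVars
  refine Fin.lastCases ?_ (fun i => ?_) i <;> simp [Finset.mul_sum]

/-- The frequency variables indexed by `S`, as a linear map. -/
def frequencyVarsRestrict {n : ℕ} (S : Finset (Fin (n + 1))) :
    EuclideanSpace ℝ (Fin n) →ₗ[ℝ] (S → ℝ) where
  toFun ξ i := frequencyVars ξ i
  map_add' ξ ζ := funext fun i => frequencyVars_add ξ ζ i
  map_smul' c ξ := funext fun i => frequencyVars_smul c ξ i

theorem isNondegenerateSubspace_binomialSubspace {k n : ℕ} (hn : 0 < n) (hkn : k ≤ n) :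
    IsNondegenerateSubspace (binomialSubspace n k) := by
  intro S hS
  have hinj : Function.Injective
      ((frequencyVarsRestrict S).comp (binomialSubspace n k).subtype) := by
    rw [← LinearMap.ker_eq_bot, LinearMap.ker_eq_bot']
    rintro ⟨_, P, hP, rfl⟩ h
    rw [finrank_binomialSubspace hn hkn] at hS
    have := eq_zero_of_frequencyVars_binomialEval hn hkn hP S hS.ge
      fun i hi => congrFun h ⟨i, hi⟩
    subst this
    simp
  refine ⟨hinj, ?_⟩
  exact (LinearMap.injective_iff_surjective_of_finrank_eq_finrank (by simp [hS])).1 hinj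

/-! ### Counting integer points. -/

/-- The integer points of `Γ` with coordinate sum zero. -/
def integerPoints {n : ℕ} (Γ : Submodule ℝ (EuclideanSpace ℝ (Fin n))) : Set (Fin n → ℤ) :=
  {v | (WithLp.toLp 2 fun i => (v i : ℝ)) ∈ Γ ∧ ∑ i, v i = 0}

/-- The points come from `(X - n) Q`, where `Q` has `l` coefficients in `{0, …, 2 ^ u - 1}`. The
root at `n` kills the dual variable, that is, the coordinate sum. -/
theorem exists_pow_le_card_integerPoints {l n : ℕ} (hln : l + 1 ≤ n) :
    ∃ s : ℕ, ∀ u : ℕ, ∃ V : Finset (Fin n → ℤ), (2 ^ u) ^ l ≤ V.card ∧ ∀ v ∈ V,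
      v ∈ integerPoints (binomialSubspace n (l + 1)) ∧
      ∀ i, v i ∈ Finset.Ico (-(2 ^ (u + s) : ℕ) : ℤ) (2 ^ (u + s) : ℕ) := by
  let A : ℕ := ∑ i : Fin n, n.choose i * n * ∑ j : Fin l, (i : ℕ) ^ (j : ℕ)
  let F (c : Fin l → ℕ) (i : Fin n) : ℤ :=
    (-1) ^ (i : ℕ) * (n.choose i : ℤ) * (((i : ℤ) - n) * ∑ j : Fin l, (c j : ℤ) * (i : ℤ) ^ (j : ℕ))
  let Q (c : Fin l → ℕ) : Polynomial ℝ :=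
    (Polynomial.degreeLTEquiv ℝ l).symm fun j => (c j : ℝ)
  let P (c : Fin l → ℕ) : Polynomial ℝ := (Polynomial.X - Polynomial.C (n : ℝ)) * Q c
  have hQ (c) (x : ℝ) : (Q c).eval x = ∑ j : Fin l, (c j : ℝ) * x ^ (j : ℕ) := by
    rw [Polynomial.eval_eq_sum_degreeLTEquiv (Subtype.property _)]
    simp
  have hP (c) : P c ∈ Polynomial.degreeLT ℝ (l + 1) := by
    rw [Polynomial.mem_degreeLT]
    have h1 : (Q c).degree < l := Polynomial.mem_degreeLT.1 (Subtype.property _)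
    rw [Polynomial.degree_mul, Polynomial.degree_X_sub_C, add_comm]
    rcases eq_or_ne (Q c) 0 with h | h
    · simp [h]
    · rw [Polynomial.degree_eq_natDegree h] at h1 ⊢
      have : (Q c).natDegree < l := by exact_mod_cast h1
      exact_mod_cast Nat.succ_lt_succ this
  have hF (c) : (WithLp.toLp 2 fun i => (F c i : ℝ)) = binomialEval n (P c) := by
    ext i
    simp [binomialEval_apply, F, P, hQ]
  have hFinj : Function.Injective F := by
    intro c c' h
    have h1 : binomialEval n (P c) = binomialEval n (P c') := by rw [← hF, ← hF, h]
    have h2 := mul_left_cancel₀ (Polynomial.X_sub_C_ne_zero _)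
      (binomialEval_injOn (by omega) hln (hP c) (hP c') h1)
    have h3 := (Polynomial.degreeLTEquiv ℝ l).symm.injective (Subtype.ext h2)
    ext j
    exact_mod_cast congrFun h3 j
  -- Coordinates are at most `A * 2 ^ u`; rounding `A` up to a power of two keeps the box dyadic,
  -- with `s` independent of `u`.
  obtain ⟨s, hs⟩ : ∃ s, A < 2 ^ s := ⟨A, Nat.lt_two_pow_self⟩
  refine ⟨s, fun u => ⟨(Fintype.piFinset fun _ : Fin l => Finset.range (2 ^ u)).image F, ?_, ?_⟩⟩
  · rw [Finset.card_image_of_injective _ hFinj]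
    simp
  · intro v hv
    obtain ⟨c, hc, rfl⟩ := Finset.mem_image.1 hv
    have hc' (j) : c j ≤ 2 ^ u := (Finset.mem_range.1 (Fintype.mem_piFinset.1 hc j)).le
    refine ⟨⟨?_, ?_⟩, fun i => ?_⟩
    · rw [hF]
      exact Submodule.mem_map_of_mem (hP c)
    · have h := frequencyVars_binomialEval
        (natDegree_lt_of_mem_degreeLT (n := n) (by omega) hln (hP c)) (Fin.last n)
      simp only [frequencyVars, Fin.snoc_last, ← hF, P] at h
      simp only [Fin.val_last, Polynomial.eval_mul, Polynomial.eval_sub, Polynomial.eval_X,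
        Polynomial.eval_C, sub_self, zero_mul, mul_zero, neg_eq_zero] at h
      exact_mod_cast h
    · have hb : |F c i| < 2 ^ (u + s) := by
        calc |F c i| = n.choose i * |(i : ℤ) - n| * ∑ j : Fin l, (c j : ℤ) * (i : ℤ) ^ (j : ℕ) := by
              simp only [F, abs_mul, abs_pow, abs_neg, abs_one, one_pow, one_mul, Nat.abs_cast]
              rw [abs_of_nonneg (a := ∑ j : Fin l, (c j : ℤ) * (i : ℤ) ^ (j : ℕ))
                (Finset.sum_nonneg fun j _ => by positivity), mul_assoc]
          _ ≤ n.choose i * n * ∑ j : Fin l, (2 ^ u : ℤ) * (i : ℤ) ^ (j : ℕ) := by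
              gcongr with j
              · rw [abs_le]; omega
              · exact_mod_cast hc' j
          _ = 2 ^ u * ((n.choose i * n * ∑ j : Fin l, (i : ℕ) ^ (j : ℕ) : ℕ) : ℤ) := by
              rw [← Finset.mul_sum]; push_cast; ring
          _ ≤ 2 ^ u * (A : ℤ) := by
              gcongr
              exact Finset.single_le_sum
                (f := fun i : Fin n => n.choose i * n * ∑ j : Fin l, (i : ℕ) ^ (j : ℕ))
                (fun _ _ => Nat.zero_le _) (Finset.mem_univ i)
          _ < 2 ^ u * 2 ^ s := by
              gcongr
              exact_mod_cast hs
          _ = 2 ^ (u + s) := (pow_add _ _ _).symm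
      rw [abs_lt] at hb
      rw [Finset.mem_Ico]
      push_cast
      exact ⟨hb.1.le, hb.2⟩

/-! ### Symbols made of bumps at lattice points. -/

/-- An integer vector, as a point of Euclidean space. -/
def latticePoint {n : ℕ} (v : Fin n → ℤ) : EuclideanSpace ℝ (Fin n) :=
  WithLp.toLp 2 fun i => (v i : ℝ)

/-- A superposition of translates of `Φ` to the integer vectors `v`, with coefficients `w v`; only
the translate to a nearest integer vector is taken into account. -/
noncomputable def latticeSymbol {n : ℕ} (w : (Fin n → ℤ) → ℂ) (Φ : EuclideanSpace ℝ (Fin n) → ℂ)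
    (η : EuclideanSpace ℝ (Fin n)) : ℂ :=
  w (fun i => round (η i)) * Φ (η - latticePoint fun i => round (η i))

section LatticeSymbol

variable {n : ℕ} {w : (Fin n → ℤ) → ℂ} {Φ : EuclideanSpace ℝ (Fin n) → ℂ}

theorem round_apply_eq_of_dist_lt {η : EuclideanSpace ℝ (Fin n)} {v : Fin n → ℤ}
    (h : dist η (latticePoint v) < 1 / 2) (i : Fin n) : round (η i) = v i := by
  have h1 : |η i - v i| < 1 / 2 := by
    rw [dist_eq_norm] at h
    exact (PiLp.norm_apply_le (η - latticePoint v) i).trans_lt h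
  rw [abs_lt] at h1
  rw [round_eq_iff, Set.mem_Ico]
  constructor <;> linarith

theorem latticeSymbol_eq_of_dist_lt {η : EuclideanSpace ℝ (Fin n)} {v : Fin n → ℤ}
    (h : dist η (latticePoint v) < 1 / 2) :
    latticeSymbol w Φ η = w v * Φ (η - latticePoint v) := by
  simp only [latticeSymbol, round_apply_eq_of_dist_lt h]

theorem latticeSymbol_eventuallyEq_of_dist_lt {η : EuclideanSpace ℝ (Fin n)} {v : Fin n → ℤ}
    (h : dist η (latticePoint v) < 1 / 2) :
    latticeSymbol w Φ =ᶠ[nhds η] fun ζ => w v • Φ (ζ - latticePoint v) := by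
  filter_upwards [(isOpen_lt (continuous_id.dist continuous_const) continuous_const).mem_nhds h]
    with ζ hζ using latticeSymbol_eq_of_dist_lt hζ

/-- The radius `1 / 6` is the gap between the support radius `1 / 3` and the distance `1 / 2`. -/
theorem latticeSymbol_eventuallyEq_zero (hΦ : ∀ ζ, 1 / 3 ≤ ‖ζ‖ → Φ ζ = 0)
    {η : EuclideanSpace ℝ (Fin n)} (h : ∀ v : Fin n → ℤ, 1 / 2 ≤ dist η (latticePoint v)) :
    latticeSymbol w Φ =ᶠ[nhds η] fun _ => 0 := by
  filter_upwards [Metric.ball_mem_nhds η (show (0 : ℝ) < 1 / 6 by norm_num)] with ζ hζ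
  rw [latticeSymbol, hΦ, mul_zero]
  have h1 := h fun i => round (ζ i)
  have h2 := dist_triangle_left η (latticePoint fun i => round (ζ i)) ζ
  rw [Metric.mem_ball] at hζ
  rw [← dist_eq_norm]
  linarith

theorem contDiff_latticeSymbol (hΦ : ∀ ζ, 1 / 3 ≤ ‖ζ‖ → Φ ζ = 0) (hs : ContDiff ℝ ∞ Φ) :
    ContDiff ℝ ∞ (latticeSymbol w Φ) := by
  rw [contDiff_iff_contDiffAt]
  intro η
  by_cases h : ∃ v : Fin n → ℤ, dist η (latticePoint v) < 1 / 2
  · obtain ⟨v, hv⟩ := h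
    refine ContDiffAt.congr_of_eventuallyEq ?_ (latticeSymbol_eventuallyEq_of_dist_lt hv)
    exact ((hs.comp (contDiff_id.sub contDiff_const)).const_smul (w v)).contDiffAt
  · push Not at h
    exact contDiffAt_const.congr_of_eventuallyEq (latticeSymbol_eventuallyEq_zero hΦ h)

/-- A lattice symbol whose coefficients are carried by `Γ` is a Mikhlin symbol. -/
theorem isMikhlinSymbol_latticeSymbol {Γ : Submodule ℝ (EuclideanSpace ℝ (Fin n))}
    (hw : ∀ v, ‖w v‖ ≤ 1) (hwΓ : ∀ v, latticePoint v ∉ Γ → w v = 0)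
    (Φ : 𝓢(EuclideanSpace ℝ (Fin n), ℂ)) (hΦ : ∀ ζ, 1 / 3 ≤ ‖ζ‖ → Φ ζ = 0) :
    IsMikhlinSymbol Γ (latticeSymbol w Φ) where
  measurable := (contDiff_latticeSymbol hΦ (Φ.smooth _)).continuous.aestronglyMeasurable
  bounded := by
    obtain ⟨C, hC⟩ := Φ.decay 0 0
    refine ⟨C, fun η => ?_⟩
    rw [latticeSymbol, norm_mul]
    have h := hC.2 (η - latticePoint fun i => round (η i))
    rw [pow_zero, one_mul, norm_iteratedFDeriv_zero] at h
    exact (mul_le_of_le_one_left (norm_nonneg _) (hw _)).trans h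
  smooth := (contDiff_latticeSymbol hΦ (Φ.smooth _)).contDiffOn
  decay j := by
    obtain ⟨C, hC0, hC⟩ := Φ.decay 0 j
    refine ⟨C, fun η hη => ?_⟩
    by_cases h : ∃ v : Fin n → ℤ, dist η (latticePoint v) < 1 / 2
    · obtain ⟨v, hv⟩ := h
      rw [((latticeSymbol_eventuallyEq_of_dist_lt hv).iteratedFDeriv ℝ j).eq_of_nhds,
        iteratedFDeriv_const_smul_apply' (f := fun ζ => Φ (ζ - latticePoint v))
          ((Φ.smooth _).comp (contDiff_id.sub contDiff_const)).contDiffAt,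
        iteratedFDeriv_comp_sub, norm_smul]
      by_cases hvΓ : latticePoint v ∈ Γ
      · have h1 := hC (η - latticePoint v)
        rw [pow_zero, one_mul] at h1
        have h2 : 0 < Metric.infDist η (Γ : Set (EuclideanSpace ℝ (Fin n))) :=
          (Γ.closed_of_finiteDimensional.notMem_iff_infDist_pos ⟨0, Γ.zero_mem⟩).1 hη
        -- Where the symbol is nonzero, `Γ` is within distance one, so a uniform derivative bound is
        -- stronger than the Mikhlin bound.
        have h3 : Metric.infDist η (Γ : Set (EuclideanSpace ℝ (Fin n))) ≤ 1 :=
          (Metric.infDist_le_dist_of_mem hvΓ).trans (hv.le.trans (by norm_num))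
        calc ‖w v‖ * ‖iteratedFDeriv ℝ j Φ (η - latticePoint v)‖ ≤ C :=
              (mul_le_of_le_one_left (norm_nonneg _) (hw _)).trans h1
          _ ≤ _ := le_div_self hC0.le (pow_pos h2 j) (pow_le_one₀ h2.le h3)
      · rw [hwΓ v hvΓ, norm_zero, zero_mul]
        exact div_nonneg hC0.le (pow_nonneg Metric.infDist_nonneg _)
    · push Not at h
      rw [((latticeSymbol_eventuallyEq_zero hΦ h).iteratedFDeriv ℝ j).eq_of_nhds,
        iteratedFDeriv_fun_zero, Pi.zero_apply, norm_zero]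
      exact div_nonneg hC0.le (pow_nonneg Metric.infDist_nonneg _)

end LatticeSymbol

/-! ### Test functions and the action of the multiplier on them. -/

/-- A smooth bump function as a complex Schwartz function. -/
noncomputable def ContDiffBump.toComplexSchwartz {E : Type*} [NormedAddCommGroup E]
    [InnerProductSpace ℝ E] [FiniteDimensional ℝ E] {c : E} (φ : ContDiffBump c) : 𝓢(E, ℂ) :=
  HasCompactSupport.toSchwartzMap (f := fun x => (φ x : ℂ))
    (φ.hasCompactSupport.comp_left Complex.ofReal_zero)
    (Complex.ofRealCLM.contDiff.comp φ.contDiff)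

theorem ContDiffBump.toComplexSchwartz_apply {E : Type*} [NormedAddCommGroup E]
    [InnerProductSpace ℝ E] [FiniteDimensional ℝ E] {c : E} (φ : ContDiffBump c) (x : E) :
    φ.toComplexSchwartz x = φ x := rfl

/-- The character `x ↦ e^{2πix}`. -/
noncomputable def expChar (x : ℝ) : ℂ := Complex.exp (2 * Real.pi * Complex.I * x)

theorem norm_expChar (x : ℝ) : ‖expChar x‖ = 1 := by
  rw [expChar, show (2 * Real.pi * Complex.I * x : ℂ) = ((2 * Real.pi * x : ℝ) : ℂ) * Complex.I by
    push_cast; ring]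
  exact Complex.norm_exp_ofReal_mul_I _

theorem fourierInv_apply_eq_integral (b : 𝓢(ℝ, ℂ)) (x : ℝ) :
    (𝓕⁻ b) x = ∫ t : ℝ, b t * Complex.exp (2 * Real.pi * Complex.I * x * t) := by
  rw [SchwartzMap.fourierInv_coe, Real.fourierInv_eq']
  refine integral_congr_ae (.of_forall fun t => ?_)
  simp only [smul_eq_mul, mul_comm (b t)]
  congr 2
  simp
  ring

theorem integral_translate_mul_exp (b : 𝓢(ℝ, ℂ)) (x : ℝ) (a : ℤ) :
    ∫ t : ℝ, b (t - a) * Complex.exp (2 * Real.pi * Complex.I * x * t) =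
      expChar x ^ a * (𝓕⁻ b) x := by
  rw [fourierInv_apply_eq_integral, ← integral_const_mul,
    ← integral_sub_right_eq_self (fun t : ℝ => expChar x ^ a *
      (b t * Complex.exp (2 * Real.pi * Complex.I * x * t))) (a : ℝ)]
  refine integral_congr_ae (.of_forall fun t => ?_)
  simp only
  rw [mul_left_comm, expChar, ← Complex.exp_int_mul, ← Complex.exp_add]
  congr 2
  push_cast
  ring

theorem integrable_translate_mul_exp (b : 𝓢(ℝ, ℂ)) (x : ℝ) (a : ℤ) :
    Integrable fun t : ℝ => b (t - a) * Complex.exp (2 * Real.pi * Complex.I * x * t) := by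
  refine (b.integrable.comp_sub_right (a : ℝ)).mul_bdd (c := 1)
    (by fun_prop : Continuous _).aestronglyMeasurable (.of_forall fun t => ?_)
  rw [show (2 * Real.pi * Complex.I * x * t : ℂ) = ((2 * Real.pi * x * t : ℝ) : ℂ) * Complex.I by
    push_cast; ring]
  exact (Complex.norm_exp_ofReal_mul_I _).le

/-- The function whose Fourier transform is `∑_{a ∈ s} d a • b(· - a)`. -/
noncomputable def modulatedSum (b : 𝓢(ℝ, ℂ)) (d : ℤ → ℝ) (s : Finset ℤ) : 𝓢(ℝ, ℂ) :=
  𝓕⁻ (∑ a ∈ s, (d a : ℂ) • b.compSubConstCLM ℂ (a : ℝ))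

theorem fourier_modulatedSum (b : 𝓢(ℝ, ℂ)) (d : ℤ → ℝ) (s : Finset ℤ) (ξ : ℝ) :
    𝓕 (modulatedSum b d s : ℝ → ℂ) ξ = ∑ a ∈ s, (d a : ℂ) * b (ξ - a) := by
  rw [← SchwartzMap.fourier_coe, modulatedSum, FourierTransform.fourier_fourierInv_eq]
  simp

theorem modulatedSum_apply (b : 𝓢(ℝ, ℂ)) (d : ℤ → ℝ) (s : Finset ℤ) (x : ℝ) :
    modulatedSum b d s x = (∑ a ∈ s, (d a : ℂ) * expChar x ^ a) * (𝓕⁻ b) x := by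
  rw [modulatedSum, fourierInv_apply_eq_integral, Finset.sum_mul]
  simp only [sum_apply, smul_apply, SchwartzMap.compSubConstCLM_apply,
    Finset.sum_mul, smul_eq_mul, mul_assoc (Complex.ofReal (d _))]
  rw [integral_finsetSum _ fun a _ => (integrable_translate_mul_exp b x a).const_mul _]
  simp only [integral_const_mul, integral_translate_mul_exp]

/-- The support of `b` is so small that `∏ b(η_i - v_i) ≠ 0` puts `η` within `1 / 4` of `v`, where
the symbol is the constant `w v`. Each term is then a product of one-dimensional integrals. -/
theorem multilinearMultiplier_latticeSymbol_modulatedSum {n : ℕ} (w : (Fin n → ℤ) → ℂ)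
    {Φ : EuclideanSpace ℝ (Fin n) → ℂ} (hΦ : ∀ ζ, ‖ζ‖ ≤ 1 / 4 → Φ ζ = 1) {b : 𝓢(ℝ, ℂ)}
    (hb : ∀ t, b t ≠ 0 → |t| ≤ 1 / (4 * n)) (d : ℤ → ℝ) (s : Finset ℤ) (x : ℝ) :
    multilinearMultiplier (latticeSymbol w Φ) (fun _ => (modulatedSum b d s : ℝ → ℂ)) x =
      (∑ v ∈ Fintype.piFinset fun _ : Fin n => s,
        w v * (∏ i, (d (v i) : ℂ)) * expChar x ^ (∑ i, v i)) * (𝓕⁻ b) x ^ n := by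
  have hpt (η : Fin n → ℝ) : latticeSymbol w Φ (WithLp.toLp 2 η) *
      (∏ i, 𝓕 (modulatedSum b d s : ℝ → ℂ) (η i)) *
        Complex.exp (2 * Real.pi * Complex.I * (x : ℂ) * ((∑ i, η i : ℝ) : ℂ)) =
      ∑ v ∈ Fintype.piFinset fun _ : Fin n => s, w v * (∏ i, (d (v i) : ℂ)) *
        ∏ i, (b (η i - v i) * Complex.exp (2 * Real.pi * Complex.I * x * η i)) := by
    have he : Complex.exp (2 * Real.pi * Complex.I * (x : ℂ) * ((∑ i, η i : ℝ) : ℂ)) =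
        ∏ i, Complex.exp (2 * Real.pi * Complex.I * x * η i) := by
      rw [← Complex.exp_sum, ← Finset.mul_sum]
      push_cast
      rfl
    simp only [fourier_modulatedSum]
    rw [Finset.prod_univ_sum, Finset.mul_sum, Finset.sum_mul]
    refine Finset.sum_congr rfl fun v _ => ?_
    rw [he]
    simp only [Finset.prod_mul_distrib]
    by_cases h0 : ∏ i, b (η i - v i) = 0
    · simp [h0]
    · have hi (i) : |η i - v i| ≤ 1 / (4 * n) :=
        hb _ (Finset.prod_ne_zero_iff.1 h0 i (Finset.mem_univ i))
      have hnorm : ‖WithLp.toLp 2 η - latticePoint v‖ ≤ 1 / 4 := by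
        rw [EuclideanSpace.norm_eq]
        refine Real.sqrt_le_iff.2 ⟨by norm_num, ?_⟩
        rcases Nat.eq_zero_or_pos n with rfl | hn
        · simp
        · have hn' : (1 : ℝ) ≤ n := by exact_mod_cast hn
          calc ∑ i, ‖(WithLp.toLp 2 η - latticePoint v) i‖ ^ 2
              ≤ ∑ _i : Fin n, (1 / (4 * n) : ℝ) ^ 2 :=
                Finset.sum_le_sum fun i _ => pow_le_pow_left₀ (norm_nonneg _) (hi i) 2
            _ = (1 / 4) ^ 2 * (1 / n) := by
                simp only [Finset.sum_const, Finset.card_univ, Fintype.card_fin, nsmul_eq_mul]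
                field_simp
            _ ≤ (1 / 4) ^ 2 := by
                refine mul_le_of_le_one_right (by norm_num) ?_
                rw [div_le_one (by linarith)]
                exact hn'
      rw [latticeSymbol_eq_of_dist_lt (v := v) (by rw [dist_eq_norm]; linarith), hΦ _ hnorm]
      ring
  unfold multilinearMultiplier
  rw [← (PiLp.volume_preserving_toLp (Fin n)).integral_comp
    (MeasurableEquiv.toLp 2 (Fin n → ℝ)).measurableEmbedding]
  simp only [hpt]
  rw [integral_finsetSum, Finset.sum_mul]
  · refine Finset.sum_congr rfl fun v _ => ?_
    rw [integral_const_mul, integral_fintype_prod_volume_eq_prod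
      (f := fun i t => b (t - v i) * Complex.exp (2 * Real.pi * Complex.I * x * t))]
    simp only [integral_translate_mul_exp, Finset.prod_mul_distrib, Finset.prod_const,
      Finset.card_univ, Fintype.card_fin]
    have hz : expChar x ≠ 0 := Complex.exp_ne_zero _
    have : ∏ i, expChar x ^ v i = expChar x ^ ∑ i, v i := by
      induction (Finset.univ : Finset (Fin n)) using Finset.induction_on with
      | empty => simp
      | insert a t ha ih => rw [Finset.prod_insert ha, Finset.sum_insert ha, zpow_add₀ hz, ih]
    rw [this]
    ring
  · intro v _
    exact (Integrable.fintype_prod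
      (f := fun i t => b (t - v i) * Complex.exp (2 * Real.pi * Complex.I * x * t))
      fun i => integrable_translate_mul_exp b x (v i)).const_mul _

/-! ### The sign-weighted symbol and its growth. -/

/-- The product of Rudin–Shapiro signs, restricted to the integer points of `Γ` with coordinate
sum zero. -/
noncomputable def signWeight {n : ℕ} (Γ : Submodule ℝ (EuclideanSpace ℝ (Fin n)))
    (v : Fin n → ℤ) : ℂ :=
  (integerPoints Γ).indicator (fun v => ∏ i, (rudinShapiroInt (v i) : ℂ)) v

theorem norm_signWeight_le {n : ℕ} (Γ : Submodule ℝ (EuclideanSpace ℝ (Fin n))) (v : Fin n → ℤ) :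
    ‖signWeight Γ v‖ ≤ 1 := by
  refine (norm_indicator_le_norm_self _ _).trans ?_
  rw [norm_prod]
  simp [abs_rudinShapiroInt]

/-- The signs in the weight cancel those of the test functions, and coordinate sum zero removes the
oscillation in `x`. Every point counted thus contributes exactly one. -/
theorem multilinearMultiplier_signWeight {n : ℕ} (Γ : Submodule ℝ (EuclideanSpace ℝ (Fin n)))
    {Φ : EuclideanSpace ℝ (Fin n) → ℂ} (hΦ : ∀ ζ, ‖ζ‖ ≤ 1 / 4 → Φ ζ = 1) {b : 𝓢(ℝ, ℂ)}
    (hb : ∀ t, b t ≠ 0 → |t| ≤ 1 / (4 * n)) (s : Finset ℤ) (x : ℝ) :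
    multilinearMultiplier (latticeSymbol (signWeight Γ) Φ)
        (fun _ => (modulatedSum b rudinShapiroInt s : ℝ → ℂ)) x =
      ((integerPoints Γ ∩ (Fintype.piFinset fun _ : Fin n => s)).ncard : ℂ) *
        (𝓕⁻ b) x ^ n := by
  classical
  rw [multilinearMultiplier_latticeSymbol_modulatedSum _ hΦ hb]
  congr 1
  have h (v : Fin n → ℤ) : signWeight Γ v * (∏ i, (rudinShapiroInt (v i) : ℂ)) *
      expChar x ^ (∑ i, v i) = if v ∈ integerPoints Γ then 1 else 0 := by
    split_ifs with hv
    · rw [signWeight, Set.indicator_of_mem hv, hv.2, zpow_zero, mul_one, ← Finset.prod_mul_distrib]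
      refine Finset.prod_eq_one fun i _ => ?_
      rw [← sq]
      exact_mod_cast rudinShapiroInt_sq (v i)
    · rw [signWeight, Set.indicator_of_notMem hv, zero_mul, zero_mul]
  simp only [h]
  rw [Finset.sum_boole, ← Set.ncard_coe_finset]
  congr 2
  ext v
  simp [and_comm]

theorem eLpNorm_modulatedSum_rudinShapiroInt_le (b : 𝓢(ℝ, ℂ)) (r : ℕ) (p : ℝ≥0∞) :
    eLpNorm (modulatedSum b rudinShapiroInt (Finset.Ico (-(2 ^ r : ℕ) : ℤ) (2 ^ r : ℕ)) : ℝ → ℂ) p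
        volume ≤
      ENNReal.ofReal (√(8 * 2 ^ r)) * eLpNorm (𝓕⁻ b : 𝓢(ℝ, ℂ)) p volume := by
  refine eLpNorm_le_mul_eLpNorm_of_ae_le_mul (.of_forall fun x => ?_) p
  rw [modulatedSum_apply, norm_mul]
  gcongr
  exact Real.le_sqrt_of_sq_le (norm_sum_rudinShapiroInt_sq_le r (norm_expChar x))

/-- Unless `2 l ≤ n`, exponential growth at rate `l` is not dominated by growth at rate `n / 2`. -/
theorem not_forall_two_pow_mul_le {l n s : ℕ} (hl : n + 1 ≤ 2 * l) {G K : ℝ≥0∞} (hG : G ≠ 0)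
    (hK : K ≠ ⊤) :
    ¬ ∀ u : ℕ, (2 ^ u) ^ l * G ≤ K * ENNReal.ofReal (√(8 * 2 ^ (u + s))) ^ n := by
  intro h
  have hD : K ^ 2 * (8 * 2 ^ s) ^ n / G ^ 2 ≠ ⊤ :=
    ENNReal.div_ne_top (by finiteness) (pow_ne_zero 2 hG)
  -- Squaring the inequality clears the half-integer exponents. Since `2 * l ≥ n + 1`, a factor `2 ^
  -- u` is left over, and it would be bounded by this constant.
  obtain ⟨u, hu⟩ := ENNReal.exists_nat_gt hD
  have hsq (r : ℕ) : ENNReal.ofReal (√(8 * 2 ^ r)) ^ 2 = 8 * 2 ^ r := by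
    rw [← ENNReal.ofReal_pow (Real.sqrt_nonneg _), Real.sq_sqrt (by positivity),
      ENNReal.ofReal_mul (by norm_num), ENNReal.ofReal_pow (by norm_num)]
    norm_num
  have h1 : (2 : ℝ≥0∞) ^ (u * n) * (2 ^ u * G ^ 2) ≤
      2 ^ (u * n) * (K ^ 2 * (8 * 2 ^ s) ^ n) := by
    calc (2 : ℝ≥0∞) ^ (u * n) * (2 ^ u * G ^ 2) = 2 ^ (u * (n + 1)) * G ^ 2 := by ring
      _ ≤ 2 ^ (u * (2 * l)) * G ^ 2 := by
          gcongr
          norm_num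
      _ = ((2 ^ u) ^ l * G) ^ 2 := by ring
      _ ≤ (K * ENNReal.ofReal (√(8 * 2 ^ (u + s))) ^ n) ^ 2 := by
          exact pow_le_pow_left' (h u) 2
      _ = K ^ 2 * (ENNReal.ofReal (√(8 * 2 ^ (u + s))) ^ 2) ^ n := by ring
      _ = _ := by rw [hsq]; ring
  have h2 := (ENNReal.mul_le_mul_iff_right (by positivity) (by finiteness)).1 h1
  rw [← ENNReal.le_div_iff_mul_le (.inl (pow_ne_zero 2 hG))
    (.inr (by finiteness))] at h2
  refine (hu.trans_le ?_).not_ge h2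
  exact_mod_cast Nat.lt_two_pow_self.le

theorem fourierInv_ne_zero {b : 𝓢(ℝ, ℂ)} (hb : b ≠ 0) : 𝓕⁻ b ≠ 0 := by
  intro h
  have h1 := FourierTransform.fourier_fourierInv_eq (F := 𝓢(ℝ, ℂ)) b
  rw [h] at h1
  refine hb (h1.symm.trans ?_)
  exact map_zero (SchwartzMap.fourierTransformCLM ℂ)

theorem eLpNorm_pow_ne_zero {g : 𝓢(ℝ, ℂ)} (hg : g ≠ 0) (n : ℕ) {q : ℝ≥0∞} (hq : q ≠ 0) :
    eLpNorm (fun x => g x ^ n) q volume ≠ 0 := by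
  have hc : Continuous fun x => g x ^ n := g.continuous.pow n
  rw [Ne, eLpNorm_eq_zero_iff hc.aestronglyMeasurable hq,
    Continuous.ae_eq_iff_eq volume hc continuous_zero]
  intro h
  exact hg (DFunLike.ext _ _ fun x => eq_zero_of_pow_eq_zero (congrFun h x))

theorem exists_schwartzMap_ne_zero {δ : ℝ} (hδ : 0 < δ) :
    ∃ b : 𝓢(ℝ, ℂ), b ≠ 0 ∧ ∀ t, b t ≠ 0 → |t| ≤ δ := by
  let φ : ContDiffBump (0 : ℝ) := ⟨δ / 2, δ, by positivity, by linarith⟩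
  refine ⟨φ.toComplexSchwartz, fun h => ?_, fun t ht => ?_⟩
  · have h1 : φ.toComplexSchwartz 0 = 1 := by
      rw [ContDiffBump.toComplexSchwartz_apply,
        φ.one_of_mem_closedBall (Metric.mem_closedBall_self φ.rIn_pos.le), Complex.ofReal_one]
    rw [h] at h1
    exact zero_ne_one h1
  · by_contra! h
    refine ht ?_
    rw [ContDiffBump.toComplexSchwartz_apply, φ.zero_of_le_dist, Complex.ofReal_zero]
    rw [Real.dist_eq, sub_zero]
    exact h.le

/-- The multiplier with symbol the Rudin–Shapiro lattice symbol along `binomialSubspace n (l + 1)`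
satisfies no Lebesgue space estimates once `l > n / 2`. -/
theorem not_mapsLp_latticeSymbol_signWeight {l n : ℕ} (hln : l + 1 ≤ n) (hl : n + 1 ≤ 2 * l)
    {Φ : EuclideanSpace ℝ (Fin n) → ℂ} (hΦ : ∀ ζ, ‖ζ‖ ≤ 1 / 4 → Φ ζ = 1)
    (p : Fin n → ℝ≥0∞) {q : ℝ≥0∞} (hq : q ≠ 0) :
    ¬ MapsLp (latticeSymbol (signWeight (binomialSubspace n (l + 1))) Φ) p q := by
  rintro ⟨C, hC⟩
  have hn : (0 : ℝ) < n := by exact_mod_cast (by omega : 0 < n)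
  obtain ⟨b, hb0, hb⟩ := exists_schwartzMap_ne_zero (show (0 : ℝ) < 1 / (4 * n) by positivity)
  obtain ⟨s, hs⟩ := exists_pow_le_card_integerPoints hln
  refine not_forall_two_pow_mul_le (s := s) hl
    (eLpNorm_pow_ne_zero (fourierInv_ne_zero hb0) n hq)
    (K := C * ∏ i, eLpNorm (𝓕⁻ b : 𝓢(ℝ, ℂ)) (p i) volume)
    (ENNReal.mul_ne_top ENNReal.coe_ne_top
      (ENNReal.prod_ne_top fun i _ => ((𝓕⁻ b).memLp (p i) volume).2.ne)) fun u => ?_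
  obtain ⟨V, hVcard, hV⟩ := hs u
  let I : Finset ℤ := Finset.Ico (-(2 ^ (u + s) : ℕ) : ℤ) (2 ^ (u + s) : ℕ)
  let A : Set (Fin n → ℤ) :=
    integerPoints (binomialSubspace n (l + 1)) ∩ (Fintype.piFinset fun _ : Fin n => I)
  have hcard : (2 ^ u) ^ l ≤ A.ncard := by
    refine hVcard.trans ?_
    rw [← Set.ncard_coe_finset]
    refine Set.ncard_le_ncard (fun v hv => ⟨(hV v hv).1, ?_⟩)
      ((Finset.finite_toSet _).subset Set.inter_subset_right)
    exact Fintype.mem_piFinset.2 (hV v hv).2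
  have hT : multilinearMultiplier (latticeSymbol (signWeight (binomialSubspace n (l + 1))) Φ)
      (fun _ => (modulatedSum b rudinShapiroInt I : ℝ → ℂ)) =
        (A.ncard : ℂ) • fun x => (𝓕⁻ b) x ^ n :=
    funext fun x => multilinearMultiplier_signWeight _ hΦ hb I x
  have h := hC fun _ => modulatedSum b rudinShapiroInt I
  rw [hT, eLpNorm_const_smul] at h
  have hprod : ∏ i, eLpNorm (modulatedSum b rudinShapiroInt I : ℝ → ℂ) (p i) volume ≤
      ENNReal.ofReal (√(8 * 2 ^ (u + s))) ^ n *
        ∏ i, eLpNorm (𝓕⁻ b : 𝓢(ℝ, ℂ)) (p i) volume := by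
    refine (Finset.prod_le_prod' fun i _ =>
      eLpNorm_modulatedSum_rudinShapiroInt_le b (u + s) (p i)).trans_eq ?_
    rw [Finset.prod_mul_distrib, Finset.prod_const, Finset.card_univ, Fintype.card_fin]
  have hcard' : (2 ^ u) ^ l ≤ ‖(A.ncard : ℂ)‖ₑ := by
    rw [← ofReal_norm, Complex.norm_natCast, ENNReal.ofReal_natCast]
    exact_mod_cast hcard
  refine (mul_le_mul_left hcard' _).trans (h.trans ?_)
  rw [mul_assoc, mul_comm (∏ i, _)]
  exact mul_le_mul_right hprod _

/-- For `n ≥ 5` one has `n² - 6n + 6 ≥ 0`, which is `√((n - 1) / 2) ≤ n / 2 - 1`. Hence `k > n / 2 +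
1`, and integrality does the rest. -/
theorem add_three_le_two_mul_of_sub_sqrt_lt {n k : ℕ} (hn : 5 ≤ n)
    (hk : (n : ℝ) - Real.sqrt (((n : ℝ) - 1) / 2) < (k : ℝ)) : n + 3 ≤ 2 * k := by
  by_contra! h
  have hn' : (5 : ℝ) ≤ n := by exact_mod_cast hn
  have h1 : (2 * k : ℝ) ≤ n + 2 := by exact_mod_cast Nat.lt_succ_iff.1 h
  have h2 : Real.sqrt (((n : ℝ) - 1) / 2) ≤ n / 2 - 1 :=
    Real.sqrt_le_iff.2 ⟨by linarith, by nlinarith⟩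
  linarith

theorem mainTheorem4 (n : ℕ) (hn : 5 ≤ n)
    (p : Fin n → ℝ≥0∞) (q : ℝ≥0∞) (hp : ∀ i, 1 < p i) (hq₀ : 0 < q) (hq : q < ⊤)
    (hpq : ∑ i, (p i)⁻¹ = q⁻¹)
    (k : ℕ) (hk : (n : ℝ) - Real.sqrt (((n : ℝ) - 1) / 2) < (k : ℝ)) (hkn : k ≤ n) :
    ∃ Γ : Submodule ℝ (EuclideanSpace ℝ (Fin n)),
      Module.finrank ℝ Γ = k ∧ IsNondegenerateSubspace Γ ∧
        ∃ m : EuclideanSpace ℝ (Fin n) → ℂ, IsMikhlinSymbol Γ m ∧ ¬ MapsLp m p q := by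
  have hk2 := add_three_le_two_mul_of_sub_sqrt_lt hn hk
  -- `l` is the growth exponent of the integer points with sum zero; `n + 3 ≤ 2 * k` becomes `n + 1
  -- ≤ 2 * l`.
  obtain ⟨l, rfl⟩ : ∃ l, k = l + 1 := ⟨k - 1, by omega⟩
  let φ : ContDiffBump (0 : EuclideanSpace ℝ (Fin n)) :=
    ⟨1 / 4, 1 / 3, by norm_num, by norm_num⟩
  refine ⟨binomialSubspace n (l + 1), finrank_binomialSubspace (by omega) hkn,
    isNondegenerateSubspace_binomialSubspace (by omega) hkn,
    latticeSymbol (signWeight (binomialSubspace n (l + 1))) φ.toComplexSchwartz,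
    isMikhlinSymbol_latticeSymbol (norm_signWeight_le _) (fun v hv => ?_) _ (fun ζ hζ => ?_),
    not_mapsLp_latticeSymbol_signWeight hkn (by omega) (fun ζ hζ => ?_) p hq₀.ne'⟩
  · exact Set.indicator_of_notMem (fun h => hv h.1) _
  · rw [ContDiffBump.toComplexSchwartz_apply, φ.zero_of_le_dist, Complex.ofReal_zero]
    rwa [dist_zero_right]
  · rw [ContDiffBump.toComplexSchwartz_apply, φ.one_of_mem_closedBall, Complex.ofReal_one]
    rwa [mem_closedBall_zero_iff]
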